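/- Let $\mathbb A$ be a unital, not necessarily associative, finite-dimensional real algebra that is alternative (the associator $[a,b,c]=(ab)c-a(bc)$ is alternating), with a real-linear anti-involution $a\mapsto a^c$. Let $\mathcal B=(v_0,v_1,\dots,v_m)$ be a hypercomplex basis in $\mathbb A$: $m\ge 1$, $v_0=1$, the $v_s$ are linearly independent over $\mathbb R$, $v_s+v_s^c=0$ and $v_sv_s^c=1$ for $1\le s\le m$, and $v_sv_t=-v_tv_s$ for distinct $s,t\in\{1,\dots,m\}$. Complete $\mathcal B$ to a real basis $(v_0,\dots,v_d)$ of $\mathbb A$. Identify $M=\operatorname{span}_{\mathbb R}(v_0,\dots,v_m)$ with the Euclidean space $\mathbb R^{m+1}$ via $x=\sum_{s=0}^m x_sv_s$. Derivatives, limits and integrals of $\mathbb A$-valued functions $f=\sum_{t=0}^d f_tv_t$ are taken componentwise. Let $$E(x)=\frac1{\sigma_m}\frac{x^c}{|x|^{m+1}}\quad(x\in M\setminus\{0\}),\qquad \sigma_m=\frac{2\,\Gamma(1/2)^{m+1}}{\Gamma((m+1)/2)},\qquad E_y(x)=E(y-x),$$ let $\partial_s=\partial/\partial x_s$, and let $\overline\partial_{\mathcal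 B}g=\sum_{s=0}^m v_s\,\partial_s g$. Let $\Omega\subset M$ be a bounded domain with smooth boundary and let $f\in C^1(\Omega,\mathbb A)\cap C(\overline\Omega,\mathbb A)$. Then for every $x\in\Omega$ the limit defining the Teodorescu transform $$T[f](x)=-\int_\Omega E_y(x)f(y)\,dV(y):=-\lim_{\varepsilon\to0^+}\int_{\Omega\setminus B(x,\varepsilon)}E_y(x)f(y)\,dV(y)$$ exists, $T[f]$ is differentiable at $x$, and for every $s=0,1,\dots,m$ $$\partial_sT[f](x)=-\lim_{\varepsilon\to0^+}\int_{\Omega\setminus B(x,\varepsilon)}\bigl(\partial_sE_y(x)\bigr)f(y)\,dV(y)+\frac{v_s^c\,f(x)}{m+1},$$ where $\partial_s$ acts on the variable $x$ of $E_y(x)$ and the limit on the right exists. In particular $$\overline\partial_{\mathcal B}T[f](x)=f(x)\qquad\text{for all }x\in\Omega,$$ so $T$ is a right inverse of the Cauchy-Riemann operator $\overline\partial_{\mathcal B}$. -/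

import Mathlib

open Filter Topology MeasureTheory
open scoped ContDiff

noncomputable section

/-- A ring (not assumed associative) is alternative if its associator `(a b) c - a (b c)`
vanishes as soon as two of its arguments coincide, that is, if it is alternating. -/
structure IsAlternativeRing (A : Type*) [NonAssocRing A] : Prop where
  left : ∀ a b : A, associator a a b = 0
  middle : ∀ a b : A, associator a b a = 0
  right : ∀ a b : A, associator b a a = 0

/-- The imaginary units: trace `x + x^c` equal to `0` and squared norm `x x^c` equal to `1`. -/
def imaginaryUnits (A : Type*) [NonAssocRing A] [StarRing A] : Set A :=
  {x | x + star x = 0 ∧ x * star x = 1}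

/-- `v = (v_0, …, v_m)` is a hypercomplex basis (of its linear span `M`). -/
structure IsHypercomplexBasis {A : Type*} [NonAssocRing A] [Module ℝ A] [StarRing A] {m : ℕ}
    (v : Fin (m + 1) → A) : Prop where
  one_le : 1 ≤ m
  linearIndependent : LinearIndependent ℝ v
  map_zero : v 0 = 1
  mem_imaginaryUnits : ∀ s, s ≠ 0 → v s ∈ imaginaryUnits A
  anticomm : ∀ s t, s ≠ 0 → t ≠ 0 → s ≠ t → v s * v t = -(v t * v s)

/-- A set has smooth boundary if near each boundary point it is the negativity set of a smooth
function whose differential does not vanish at that point. -/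
def HasSmoothBoundary {n : ℕ} (Ω : Set (EuclideanSpace ℝ (Fin n))) : Prop :=
  ∀ p ∈ frontier Ω, ∃ U : Set (EuclideanSpace ℝ (Fin n)), IsOpen U ∧ p ∈ U ∧
    ∃ ρ : EuclideanSpace ℝ (Fin n) → ℝ, ContDiffOn ℝ ∞ ρ U ∧ fderiv ℝ ρ p ≠ 0 ∧
      ∀ q ∈ U, q ∈ Ω ↔ ρ q < 0

/-! Calculus for functions with values in the finite-dimensional real space `A`, all of it
componentwise with respect to a basis `b` of `A` (nothing depends on the choice of `b`). -/

section Components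

variable {A : Type*} [NonAssocRing A] [Module ℝ A] {d n : ℕ}

/-- The `t`-th real component `f_t` of `f = ∑ t, f_t v_t`. -/
def component {X : Type*} (b : Module.Basis (Fin (d + 1)) ℝ A) (f : X → A) (t : Fin (d + 1)) :
    X → ℝ :=
  fun x => b.repr (f x) t

/-- `f ∈ C(S, A)`. -/
def ContinuousOnComponents (b : Module.Basis (Fin (d + 1)) ℝ A)
    (f : EuclideanSpace ℝ (Fin n) → A) (S : Set (EuclideanSpace ℝ (Fin n))) : Prop :=
  ∀ t, ContinuousOn (component b f t) S

/-- `f ∈ C^k(Ω, A)`, for an open set `Ω`. -/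
def ContDiffOnComponents (b : Module.Basis (Fin (d + 1)) ℝ A) (k : ℕ)
    (f : EuclideanSpace ℝ (Fin n) → A) (Ω : Set (EuclideanSpace ℝ (Fin n))) : Prop :=
  ∀ t, ContDiffOn ℝ k (component b f t) Ω

/-- `f` is (totally) differentiable at `x`. -/
def DifferentiableAtComponents (b : Module.Basis (Fin (d + 1)) ℝ A)
    (f : EuclideanSpace ℝ (Fin n) → A) (x : EuclideanSpace ℝ (Fin n)) : Prop :=
  ∀ t, DifferentiableAt ℝ (component b f t) x

/-- The partial derivative `∂f/∂x_s` at `x`. -/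
def partialDeriv (b : Module.Basis (Fin (d + 1)) ℝ A) (s : Fin n)
    (f : EuclideanSpace ℝ (Fin n) → A) (x : EuclideanSpace ℝ (Fin n)) : A :=
  ∑ t, lineDeriv ℝ (component b f t) x (EuclideanSpace.single s (1 : ℝ)) • b t

/-- The principal value of `∫_Ω g dV` with respect to the point `x` exists: `g` is integrable on
`Ω` off every ball around `x`, and the integrals over `Ω ∖ B(x, ε)` converge as `ε → 0+`. -/
def PVConvergent (b : Module.Basis (Fin (d + 1)) ℝ A) (Ω : Set (EuclideanSpace ℝ (Fin n)))
    (x : EuclideanSpace ℝ (Fin n)) (g : EuclideanSpace ℝ (Fin n) → A) : Prop :=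
  ∀ t, (∀ ε > 0, IntegrableOn (component b g t) (Ω \ Metric.ball x ε)) ∧
    ∃ l : ℝ, Tendsto (fun ε : ℝ => ∫ y in Ω \ Metric.ball x ε, component b g t y)
      (𝓝[>] 0) (𝓝 l)

/-- The principal value `lim_{ε → 0+} ∫_{Ω ∖ B(x, ε)} g dV`, meaningful under `PVConvergent`. -/
def pvIntegral (b : Module.Basis (Fin (d + 1)) ℝ A) (Ω : Set (EuclideanSpace ℝ (Fin n)))
    (x : EuclideanSpace ℝ (Fin n)) (g : EuclideanSpace ℝ (Fin n) → A) : A :=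
  ∑ t, limUnder (𝓝[>] (0 : ℝ))
    (fun ε : ℝ => ∫ y in Ω \ Metric.ball x ε, component b g t y) • b t

end Components

section Kernel

variable {A : Type*} [NonAssocRing A] [Module ℝ A] {d m : ℕ}

/-- The point `∑ s, x_s v_s` of `M` with coordinates `x`. -/
def hypercomplexPoint (v : Fin (m + 1) → A) (x : EuclideanSpace ℝ (Fin (m + 1))) : A :=
  ∑ s, x s • v s

/-- The area `σ_m` of the unit sphere of `ℝ^(m+1)`. -/
def sphereArea (m : ℕ) : ℝ :=
  2 * Real.Gamma (1 / 2) ^ (m + 1) / Real.Gamma (((m : ℝ) + 1) / 2)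

/-- The Cauchy kernel `E(x) = x^c / (σ_m |x|^(m+1))`. -/
def cauchyKernel [StarRing A] (v : Fin (m + 1) → A) (x : EuclideanSpace ℝ (Fin (m + 1))) : A :=
  (1 / (sphereArea m * ‖x‖ ^ (m + 1))) • star (hypercomplexPoint v x)

/-- `E_y(x) = E(y - x)`. -/
def cauchyKernelAt [StarRing A] (v : Fin (m + 1) → A) (y x : EuclideanSpace ℝ (Fin (m + 1))) : A :=
  cauchyKernel v (y - x)

/-- The Teodorescu transform `T[f](x) = - p.v. ∫_Ω E_y(x) f(y) dV(y)`. -/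
def teodorescu [StarRing A] (b : Module.Basis (Fin (d + 1)) ℝ A) (v : Fin (m + 1) → A)
    (Ω : Set (EuclideanSpace ℝ (Fin (m + 1)))) (f : EuclideanSpace ℝ (Fin (m + 1)) → A)
    (x : EuclideanSpace ℝ (Fin (m + 1))) : A :=
  -pvIntegral b Ω x (fun y => cauchyKernelAt v y x * f y)

/-- The Cauchy-Riemann operator `∑ s, v_s ∂_s`, acting from the left. -/
def cauchyRiemann (b : Module.Basis (Fin (d + 1)) ℝ A) (v : Fin (m + 1) → A)
    (f : EuclideanSpace ℝ (Fin (m + 1)) → A) (x : EuclideanSpace ℝ (Fin (m + 1))) : A :=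
  ∑ s, v s * partialDeriv b s f x

end Kernel

end

/-! With n = m + 1, the coefficients of the Cauchy kernel along the `star (v s)` are, up to the
factor 1/σ_m, the scalar Riesz kernels K_w(z) = ⟨w, z⟩ / |z|^n with w = e_s. Expanding f in the
basis `b` therefore reduces the differentiation formula to a statement about real potentials ∫_Ω
K_w(y - x) g(y) dy.

The kernel has order n - 1 < n, so the potential converges absolutely, but its derivative has the
critical order n. The jump term is found without surface integrals: K_w is replaced inside B(0, ε)
by the linear function ⟨w, z⟩ / ε^n. The result is Lipschitz and can be integrated by parts on the
whole space; the ball contributes ⟨w, e⟩ ε^(-n) ∫_{B(0, ε)} g, which tends to ⟨w, e⟩ |B(0, 1)| g(0)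
(`tendsto_setIntegral_rieszKernelDeriv_mul`). Since |B(0, 1)| = σ_m / (m + 1), this is the term
v_s^c f(x) / (m + 1). A cutoff near x extends the formula to densities on Ω
(`exists_hasFDerivAt_rieszPotential`).

For the Cauchy-Riemann equation, the jump terms add up to f(x) because v_s (v_s^c p) = p in an
alternative algebra. The principal values cancel: ∂_j K_{e_s} is symmetric and trace-free in (s, j),
being a multiple of the Hessian of the fundamental solution of the Laplacian, while v_j (v_s^c p) is
antisymmetric for j ≠ s (`IsHypercomplexBasis.sum_smul_mul_star_mul_eq_zero`). -/

/-! ### The scalar Riesz kernel, its derivative and its Lipschitz truncation. -/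

section RieszKernel

variable {E : Type*} [NormedAddCommGroup E] [InnerProductSpace ℝ E]

/-- The vector Riesz kernel `z / |z|^n` on an `n`-dimensional space, paired with `w`. -/
noncomputable def rieszKernel (w z : E) : ℝ :=
  inner ℝ w z / ‖z‖ ^ Module.finrank ℝ E

/-- The derivative of `rieszKernel w` away from the origin. -/
noncomputable def rieszKernelDeriv (w z : E) : E →L[ℝ] ℝ :=
  (‖z‖ ^ Module.finrank ℝ E)⁻¹ • innerSL ℝ w -
    (Module.finrank ℝ E * inner ℝ w z / ‖z‖ ^ (Module.finrank ℝ E + 2)) • innerSL ℝ z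

/-- The kernel `rieszKernel w`, made Lipschitz by a linear modification inside `B(0, ε)`. -/
noncomputable def truncatedRieszKernel (ε : ℝ) (w z : E) : ℝ :=
  inner ℝ w z / max ‖z‖ ε ^ Module.finrank ℝ E

theorem rieszKernelDeriv_apply (w z e : E) :
    rieszKernelDeriv w z e = inner ℝ w e / ‖z‖ ^ Module.finrank ℝ E -
      Module.finrank ℝ E * inner ℝ w z * inner ℝ z e / ‖z‖ ^ (Module.finrank ℝ E + 2) := by
  simp [rieszKernelDeriv]
  ring

theorem rieszKernel_neg (w z : E) : rieszKernel w (-z) = -rieszKernel w z := by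
  simp [rieszKernel, neg_div]

/-- The quotient by ‖z‖ ^ 2 stands for the exponent k - 2, which would truncate in `ℕ`. -/
theorem hasFDerivAt_norm_pow {z : E} (hz : z ≠ 0) (k : ℕ) :
    HasFDerivAt (fun y : E => ‖y‖ ^ k) ((k * ‖z‖ ^ k / ‖z‖ ^ 2) • innerSL ℝ z) z := by
  have hz' : ‖z‖ ≠ 0 := norm_ne_zero_iff.mpr hz
  have h1 : HasFDerivAt (fun y : E => ‖y‖) (‖z‖⁻¹ • innerSL ℝ z) z := by
    have h := (hasStrictFDerivAt_norm_sq z).hasFDerivAt.sqrt (by positivity)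
    simp only [Real.sqrt_sq (norm_nonneg _)] at h
    refine h.congr_fderiv ?_
    ext y
    simp
    field_simp
  refine (h1.pow k).congr_fderiv ?_
  ext y
  rcases k with _ | k
  · simp
  · simp
    field_simp
    ring

theorem hasFDerivAt_rieszKernel (w : E) {z : E} (hz : z ≠ 0) :
    HasFDerivAt (rieszKernel w) (rieszKernelDeriv w z) z := by
  have hz' : ‖z‖ ≠ 0 := norm_ne_zero_iff.mpr hz
  have h1 := (innerSL ℝ w).hasFDerivAt (x := z)
  have h2 := (hasDerivAt_inv (pow_ne_zero (Module.finrank ℝ E) hz')).comp_hasFDerivAt z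
    (hasFDerivAt_norm_pow hz (Module.finrank ℝ E))
  have h := h1.mul h2
  have h3 : rieszKernel w = fun y => innerSL ℝ w y * (‖y‖ ^ Module.finrank ℝ E)⁻¹ := by
    ext y; simp [rieszKernel, div_eq_mul_inv]
  rw [h3]
  refine h.congr_fderiv ?_
  ext y
  simp [rieszKernelDeriv]
  field_simp
  ring

/-- Cauchy-Schwarz; the real exponent is the form used by the local integrability criterion. -/
theorem abs_rieszKernel_le (w z : E) :
    |rieszKernel w z| ≤ ‖w‖ * ‖z‖ ^ (-((Module.finrank ℝ E : ℝ) - 1)) := by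
  rcases eq_or_ne z 0 with rfl | hz
  · simp [rieszKernel]; positivity
  have hz' : 0 < ‖z‖ := norm_pos_iff.mpr hz
  rw [neg_sub, Real.rpow_sub hz', Real.rpow_one, Real.rpow_natCast, rieszKernel, abs_div, abs_pow,
    abs_norm, ← mul_div_assoc]
  gcongr
  exact abs_real_inner_le_norm w z

theorem norm_rieszKernelDeriv_le (w z : E) :
    ‖rieszKernelDeriv w z‖ ≤ (Module.finrank ℝ E + 1) * ‖w‖ / ‖z‖ ^ Module.finrank ℝ E := by
  refine ContinuousLinearMap.opNorm_le_bound _ (by positivity) fun e => ?_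
  rcases eq_or_ne z 0 with rfl | hz
  · rw [rieszKernelDeriv_apply]
    simp only [inner_zero_right, inner_zero_left, mul_zero, zero_div, sub_zero, norm_div]
    have := abs_real_inner_le_norm w e
    rw [div_mul_eq_mul_div, norm_pow, norm_norm]
    gcongr
    rw [Real.norm_eq_abs]
    refine this.trans ?_
    nlinarith [mul_nonneg (norm_nonneg w) (norm_nonneg e),
      mul_nonneg (Nat.cast_nonneg (α := ℝ) (Module.finrank ℝ E))
        (mul_nonneg (norm_nonneg w) (norm_nonneg e))]
  have hz' : 0 < ‖z‖ := norm_pos_iff.mpr hz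
  rw [rieszKernelDeriv_apply, Real.norm_eq_abs]
  refine (abs_sub _ _).trans ?_
  rw [abs_div, abs_div, abs_mul, abs_mul, abs_pow, abs_pow, abs_norm, Nat.abs_cast]
  have h1 := abs_real_inner_le_norm w e
  have h2 := abs_real_inner_le_norm w z
  have h3 := abs_real_inner_le_norm z e
  calc _ ≤ ‖w‖ * ‖e‖ / ‖z‖ ^ Module.finrank ℝ E +
        Module.finrank ℝ E * (‖w‖ * ‖z‖) * (‖z‖ * ‖e‖) / ‖z‖ ^ (Module.finrank ℝ E + 2) := by
        gcongr
    _ = _ := by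
        field_simp
        ring

/-- Bernoulli's inequality for (a / b) ^ n. The factor a on the left absorbs the growth of ⟨w, x⟩ in
the Lipschitz estimate for the truncated kernel. -/
theorem sub_inv_pow_mul_le {a b ε : ℝ} (hε : 0 < ε) (ha : ε ≤ a) (hab : a ≤ b) (n : ℕ) :
    a * ((a ^ n)⁻¹ - (b ^ n)⁻¹) ≤ n * (b - a) / ε ^ n := by
  have ha0 : 0 < a := hε.trans_le ha
  have hb0 : 0 < b := ha0.trans_le hab
  have h1 : 1 + (n : ℝ) * (a / b - 1) ≤ (1 + (a / b - 1)) ^ n :=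
    one_add_mul_le_pow (by have : 0 < a / b := by positivity
                           linarith) n
  rw [add_sub_cancel, div_pow] at h1
  have h2 : a * ((a ^ n)⁻¹ - (b ^ n)⁻¹) = a * (1 - a ^ n / b ^ n) / a ^ n := by
    field_simp
  have h3 : a * (1 - a ^ n / b ^ n) ≤ n * (b - a) := by
    have h4 : a * (1 - a ^ n / b ^ n) ≤ a * (n * (1 - a / b)) := by
      gcongr; linarith
    have h5 : a * (n * (1 - a / b)) = n * (b - a) * (a / b) := by field_simp
    have h6 : a / b ≤ 1 := (div_le_one hb0).mpr hab
    have h7 : 0 ≤ n * (b - a) := mul_nonneg (Nat.cast_nonneg _) (sub_nonneg.mpr hab)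
    nlinarith
  rw [h2]
  have h7 : 0 ≤ n * (b - a) := mul_nonneg (Nat.cast_nonneg _) (sub_nonneg.mpr hab)
  gcongr

theorem abs_truncatedRieszKernel_sub_le {ε : ℝ} (hε : 0 < ε) (w x y : E)
    (hxy : max ‖x‖ ε ≤ max ‖y‖ ε) :
    |truncatedRieszKernel ε w x - truncatedRieszKernel ε w y| ≤
      (Module.finrank ℝ E + 1) * ‖w‖ / ε ^ Module.finrank ℝ E * ‖x - y‖ := by
  set n := Module.finrank ℝ E
  set a := max ‖x‖ ε with ha
  set b := max ‖y‖ ε with hb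
  have ha' : ε ≤ a := le_max_right _ _
  have hb' : ε ≤ b := le_max_right _ _
  have h := sub_inv_pow_mul_le hε ha' hxy n
  have hba : b - a ≤ ‖x - y‖ := by
    have h1 : |max ‖y‖ ε - max ‖x‖ ε| ≤ |‖y‖ - ‖x‖| := abs_max_sub_max_le_abs _ _ _
    rw [norm_sub_rev]
    exact (le_abs_self _).trans (h1.trans (abs_norm_sub_norm_le _ _))
  -- The difference of inverse powers is paired with x, the point of smaller truncated radius, so
  -- that |⟨w, x⟩| ≤ ‖w‖ a.
  have e : truncatedRieszKernel ε w x - truncatedRieszKernel ε w y =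
      inner ℝ w (x - y) / b ^ n + inner ℝ w x * ((a ^ n)⁻¹ - (b ^ n)⁻¹) := by
    simp only [truncatedRieszKernel, inner_sub_right]
    ring
  have hi : 0 ≤ (a ^ n)⁻¹ - (b ^ n)⁻¹ := by
    have : 0 < a := hε.trans_le ha'
    rw [sub_nonneg]
    gcongr
  rw [e]
  refine (abs_add_le _ _).trans ?_
  rw [abs_mul, abs_of_nonneg hi, abs_div, abs_of_nonneg (pow_nonneg (hε.le.trans hb') n)]
  have h1 := abs_real_inner_le_norm w (x - y)
  have h2 : |inner ℝ w x| ≤ ‖w‖ * a :=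
    (abs_real_inner_le_norm w x).trans (by gcongr; exact le_max_left _ _)
  calc _ ≤ ‖w‖ * ‖x - y‖ / ε ^ n + ‖w‖ * a * ((a ^ n)⁻¹ - (b ^ n)⁻¹) := by gcongr
    _ ≤ ‖w‖ * ‖x - y‖ / ε ^ n + ‖w‖ * (n * ‖x - y‖ / ε ^ n) := by
        rw [mul_assoc]
        gcongr
        exact h.trans (by gcongr)
    _ = _ := by ring

theorem lipschitzWith_truncatedRieszKernel {ε : ℝ} (hε : 0 < ε) (w : E) :
    ∃ C, LipschitzWith C (truncatedRieszKernel ε w) := by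
  refine ⟨_, LipschitzWith.of_dist_le' (K := (Module.finrank ℝ E + 1) * ‖w‖ /
    ε ^ Module.finrank ℝ E) fun x y => ?_⟩
  rw [Real.dist_eq, dist_eq_norm]
  rcases le_total (max ‖x‖ ε) (max ‖y‖ ε) with h | h
  · exact abs_truncatedRieszKernel_sub_le hε w x y h
  · rw [abs_sub_comm, norm_sub_rev]
    exact abs_truncatedRieszKernel_sub_le hε w y x h

theorem truncatedRieszKernel_eq {ε : ℝ} {w z : E} (h : ε ≤ ‖z‖) :
    truncatedRieszKernel ε w z = rieszKernel w z := by
  rw [truncatedRieszKernel, rieszKernel, max_eq_left h]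

theorem abs_truncatedRieszKernel_le (ε : ℝ) (w z : E) :
    |truncatedRieszKernel ε w z| ≤ |rieszKernel w z| := by
  rcases eq_or_ne z 0 with rfl | hz
  · simp [truncatedRieszKernel]
  have hz' : 0 < ‖z‖ := norm_pos_iff.mpr hz
  have hm : ‖z‖ ≤ max ‖z‖ ε := le_max_left _ _
  rw [truncatedRieszKernel, rieszKernel, abs_div, abs_div, abs_pow, abs_pow,
    abs_of_pos (hz'.trans_le hm), abs_norm]
  gcongr

theorem lineDeriv_truncatedRieszKernel_of_lt_norm {ε : ℝ} (hε : 0 < ε) (w e : E) {z : E}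
    (hz : ε < ‖z‖) :
    lineDeriv ℝ (truncatedRieszKernel ε w) z e = rieszKernelDeriv w z e := by
  have h1 : truncatedRieszKernel ε w =ᶠ[𝓝 z] rieszKernel w := by
    filter_upwards [(isOpen_lt continuous_const continuous_norm).mem_nhds hz] with y hy
    exact truncatedRieszKernel_eq (le_of_lt hy)
  rw [h1.lineDeriv_eq]
  exact ((hasFDerivAt_rieszKernel w (norm_pos_iff.mp (hε.trans hz))).hasLineDerivAt e).lineDeriv

theorem lineDeriv_truncatedRieszKernel_of_norm_lt {ε : ℝ} (w e : E) {z : E}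
    (hz : ‖z‖ < ε) :
    lineDeriv ℝ (truncatedRieszKernel ε w) z e =
      inner ℝ w e * (ε ^ Module.finrank ℝ E)⁻¹ := by
  have h1 : truncatedRieszKernel ε w =ᶠ[𝓝 z]
      fun y => innerSL ℝ w y * (ε ^ Module.finrank ℝ E)⁻¹ := by
    filter_upwards [(isOpen_lt continuous_norm continuous_const).mem_nhds hz] with y hy
    rw [truncatedRieszKernel, max_eq_right (le_of_lt hy), div_eq_mul_inv, innerSL_apply_apply]
  rw [h1.lineDeriv_eq]
  have h := ((innerSL ℝ w).hasFDerivAt (x := z)).mul_const (ε ^ Module.finrank ℝ E)⁻¹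
  rw [(h.hasLineDerivAt e).lineDeriv]
  simp [mul_comm]

/-! ### Integration by parts and the distributional derivative of the kernel. -/

variable [FiniteDimensional ℝ E] [MeasurableSpace E] [BorelSpace E]

theorem measurable_rieszKernel (w : E) : Measurable (rieszKernel w) := by
  unfold rieszKernel
  fun_prop

theorem measurable_rieszKernelDeriv_apply (w e : E) :
    Measurable fun z => rieszKernelDeriv w z e := by
  simp only [rieszKernelDeriv_apply]
  fun_prop

theorem locallyIntegrable_rieszKernel (hE : 1 ≤ Module.finrank ℝ E) (w : E) :
    LocallyIntegrable (rieszKernel w) :=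
  locallyIntegrable_of_norm_le_rpow hE (α := (Module.finrank ℝ E : ℝ) - 1) (by linarith)
    (.of_forall fun z => abs_rieszKernel_le w z) (measurable_rieszKernel w).aestronglyMeasurable

/-- Integration by parts for the truncated kernel. -/
theorem setIntegral_rieszKernelDeriv_mul_eq {ε : ℝ} (hε : 0 < ε) (w e : E) {g : E → ℝ}
    (hg : ContDiff ℝ 1 g) (hgc : HasCompactSupport g) :
    ∫ z in (Metric.ball (0 : E) ε)ᶜ, rieszKernelDeriv w z e * g z =
      -(∫ z, truncatedRieszKernel ε w z * fderiv ℝ g z e) -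
        inner ℝ w e * ((ε ^ Module.finrank ℝ E)⁻¹ * ∫ z in Metric.ball (0 : E) ε, g z) := by
  obtain ⟨C, hC⟩ := lipschitzWith_truncatedRieszKernel hε w
  obtain ⟨D, hD⟩ := hg.lipschitzWith_of_hasCompactSupport hgc one_ne_zero
  -- Both factors are Lipschitz and one has compact support, so no surface term arises on the sphere
  -- of radius ε.
  have key := hC.integral_lineDeriv_mul_eq (μ := volume) hD hgc e
  have hint : Integrable fun z => lineDeriv ℝ (truncatedRieszKernel ε w) z e * g z := by
    refine ((hg.continuous.integrable_of_hasCompactSupport hgc).bdd_mul (c := C * ‖e‖)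
      (aestronglyMeasurable_lineDeriv hC.continuous volume) ?_)
    exact .of_forall fun z => norm_lineDeriv_le_of_lipschitz ℝ hC
  rw [← integral_add_compl (Metric.isOpen_ball (x := (0 : E)) (ε := ε)).measurableSet hint] at key
  have hin : ∫ z in Metric.ball (0 : E) ε, lineDeriv ℝ (truncatedRieszKernel ε w) z e * g z =
      inner ℝ w e * ((ε ^ Module.finrank ℝ E)⁻¹ * ∫ z in Metric.ball (0 : E) ε, g z) := by
    rw [← mul_assoc, ← integral_const_mul]
    refine setIntegral_congr_fun Metric.isOpen_ball.measurableSet fun z hz => ?_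
    simp only [lineDeriv_truncatedRieszKernel_of_norm_lt w e (mem_ball_zero_iff.mp hz)]
  have hout : ∫ z in (Metric.ball (0 : E) ε)ᶜ,
      lineDeriv ℝ (truncatedRieszKernel ε w) z e * g z =
      ∫ z in (Metric.ball (0 : E) ε)ᶜ, rieszKernelDeriv w z e * g z := by
    refine setIntegral_congr_ae Metric.isOpen_ball.measurableSet.compl ?_
    -- The two formulas for the truncated kernel meet on this null set, where its derivative is not
    -- computed.
    have hs : ∀ᵐ z : E, z ∉ Metric.sphere (0 : E) ε :=
      measure_eq_zero_iff_ae_notMem.mp (Measure.addHaar_sphere_of_ne_zero volume 0 hε.ne')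
    filter_upwards [hs] with z hz hz'
    have h1 : ε ≤ ‖z‖ := by simpa using hz'
    have h2 : ‖z‖ ≠ ε := by simpa using hz
    rw [lineDeriv_truncatedRieszKernel_of_lt_norm hε w e (lt_of_le_of_ne h1 h2.symm)]
  have hr : ∫ z, lineDeriv ℝ g z (-e) * truncatedRieszKernel ε w z =
      -(∫ z, truncatedRieszKernel ε w z * fderiv ℝ g z e) := by
    rw [← integral_neg]
    refine integral_congr_ae (.of_forall fun z => ?_)
    simp only [(hg.differentiable one_ne_zero z).lineDeriv_eq_fderiv, map_neg]
    ring
  rw [hin, hout, hr] at key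
  linarith

/-- Rescaling to the unit ball turns the expression into ∫ g(ε z) dz, and dominated convergence
applies. -/
theorem tendsto_inv_pow_mul_integral_ball {g : E → ℝ} (hg : Continuous g) :
    Tendsto (fun ε : ℝ => (ε ^ Module.finrank ℝ E)⁻¹ * ∫ z in Metric.ball (0 : E) ε, g z)
      (𝓝[>] 0) (𝓝 (volume.real (Metric.ball (0 : E) 1) * g 0)) := by
  have h1 : (fun ε : ℝ => (ε ^ Module.finrank ℝ E)⁻¹ * ∫ z in Metric.ball (0 : E) ε, g z)
      =ᶠ[𝓝[>] 0] fun ε => ∫ z in Metric.ball (0 : E) 1, g (ε • z) := by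
    filter_upwards [self_mem_nhdsWithin] with ε (hε : 0 < ε)
    rw [Measure.setIntegral_comp_smul_of_pos volume g _ hε, smul_ball hε.ne', smul_zero,
      Real.norm_of_nonneg hε.le, mul_one, smul_eq_mul]
  refine Tendsto.congr' h1.symm ?_
  have h2 : volume.real (Metric.ball (0 : E) 1) * g 0 = ∫ z in Metric.ball (0 : E) 1, g 0 := by
    simp
  rw [h2]
  obtain ⟨C, hC⟩ := (isCompact_closedBall (0 : E) 1).exists_bound_of_continuousOn hg.continuousOn
  refine tendsto_integral_filter_of_dominated_convergence (fun _ => C) ?_ ?_ ?_ ?_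
  · exact .of_forall fun ε => (hg.comp (continuous_const_smul ε)).aestronglyMeasurable
  · filter_upwards [Ioo_mem_nhdsGT (zero_lt_one' ℝ)] with ε hε
    refine (ae_restrict_iff' Metric.isOpen_ball.measurableSet).mpr (.of_forall fun z hz => ?_)
    refine hC _ ?_
    rw [mem_closedBall_zero_iff, norm_smul, Real.norm_of_nonneg hε.1.le]
    exact mul_le_one₀ hε.2.le (norm_nonneg _) (mem_ball_zero_iff.mp hz).le
  · exact integrableOn_const (by finiteness)
  · refine .of_forall fun z => ?_
    have : Tendsto (fun ε : ℝ => g (ε • z)) (𝓝 0) (𝓝 (g ((0 : ℝ) • z))) :=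
      (hg.comp (continuous_id.smul continuous_const)).tendsto 0
    rw [zero_smul] at this
    exact this.mono_left nhdsWithin_le_nhds

/-- Dominated convergence: truncation only decreases the absolute value, and at each z ≠ 0 the
truncated kernel equals the kernel once ε < ‖z‖. -/
theorem tendsto_integral_truncatedRieszKernel_mul (hE : 1 ≤ Module.finrank ℝ E) (w : E)
    {g : E → ℝ} (hg : Continuous g) (hgc : HasCompactSupport g) :
    Tendsto (fun ε : ℝ => ∫ z, truncatedRieszKernel ε w z * g z) (𝓝[>] 0)
      (𝓝 (∫ z, rieszKernel w z * g z)) := by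
  have hint : Integrable fun z => rieszKernel w z * g z := by
    simpa [mul_comm] using
      (locallyIntegrable_rieszKernel hE w).integrable_smul_left_of_hasCompactSupport hg hgc
  refine tendsto_integral_filter_of_dominated_convergence _ ?_ ?_ hint.norm ?_
  · filter_upwards [self_mem_nhdsWithin] with ε (hε : 0 < ε)
    obtain ⟨C, hC⟩ := lipschitzWith_truncatedRieszKernel hε w
    exact (hC.continuous.mul hg).aestronglyMeasurable
  · refine .of_forall fun ε => .of_forall fun z => ?_
    rw [norm_mul, norm_mul]
    gcongr
    exact abs_truncatedRieszKernel_le ε w z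
  · have : Nontrivial E := Module.nontrivial_of_finrank_pos (R := ℝ) hE
    filter_upwards [(measure_eq_zero_iff_ae_notMem (μ := (volume : Measure E))).mp
      (measure_singleton 0)] with z hz
    have hz' : 0 < ‖z‖ := norm_pos_iff.mpr hz
    refine tendsto_const_nhds.congr' ?_
    filter_upwards [Ioo_mem_nhdsGT hz'] with ε hε
    rw [truncatedRieszKernel_eq hε.2.le]

/-- The distributional derivative of the Riesz kernel is the principal value of its pointwise
derivative plus a multiple of the Dirac mass. -/
theorem tendsto_setIntegral_rieszKernelDeriv_mul (hE : 1 ≤ Module.finrank ℝ E) (w e : E)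
    {g : E → ℝ} (hg : ContDiff ℝ 1 g) (hgc : HasCompactSupport g) :
    Tendsto (fun ε : ℝ => ∫ z in (Metric.ball (0 : E) ε)ᶜ, rieszKernelDeriv w z e * g z) (𝓝[>] 0)
      (𝓝 (-(∫ z, rieszKernel w z * fderiv ℝ g z e) -
        inner ℝ w e * (volume.real (Metric.ball (0 : E) 1) * g 0))) := by
  have h1 := tendsto_integral_truncatedRieszKernel_mul hE w
    ((hg.continuous_fderiv one_ne_zero).clm_apply (continuous_const (y := e)))
    (hgc.fderiv_apply ℝ e)
  refine (h1.neg.sub ((tendsto_inv_pow_mul_integral_ball hg.continuous).const_mul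
    (inner ℝ w e))).congr' ?_
  filter_upwards [self_mem_nhdsWithin] with ε hε
  exact (setIntegral_rieszKernelDeriv_mul_eq hε w e hg hgc).symm

end RieszKernel

/-! ### Differentiation of Riesz potentials. -/

section RieszPotential

/-- For an integrable function the principal value is the ordinary integral; this covers the
Teodorescu transform itself. -/
theorem tendsto_setIntegral_diff_ball {X : Type*} [MetricSpace X] [MeasurableSpace X]
    [OpensMeasurableSpace X] {μ : Measure X} [NullSingletonClass μ] {s : Set X}
    (x : X) {g : X → ℝ} (hg : IntegrableOn g s μ) :
    Tendsto (fun ε : ℝ => ∫ y in s \ Metric.ball x ε, g y ∂μ) (𝓝[>] 0) (𝓝 (∫ y in s, g y ∂μ)) := by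
  have h (ε : ℝ) : ∫ y in s \ Metric.ball x ε, g y ∂μ =
      ∫ y in s, (Metric.ball x ε)ᶜ.indicator g y ∂μ := by
    rw [setIntegral_indicator Metric.isOpen_ball.measurableSet.compl, Set.sdiff_eq]
  simp_rw [h]
  refine tendsto_integral_filter_of_dominated_convergence _ ?_ ?_ hg.norm ?_
  · exact .of_forall fun ε => hg.aestronglyMeasurable.indicator
      Metric.isOpen_ball.measurableSet.compl
  · exact .of_forall fun ε => .of_forall fun y => norm_indicator_le_norm_self _ _
  · filter_upwards [ae_restrict_of_ae ((measure_eq_zero_iff_ae_notMem (μ := μ)).mp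
      (measure_singleton x))] with y hy
    have hy' : 0 < dist y x := dist_pos.mpr hy
    refine tendsto_const_nhds.congr' ?_
    filter_upwards [Ioo_mem_nhdsGT hy'] with ε hε
    rw [Set.indicator_of_mem]
    simpa using hε.2.le

variable {E : Type*} [NormedAddCommGroup E] [InnerProductSpace ℝ E] [FiniteDimensional ℝ E]
  [MeasurableSpace E] [BorelSpace E]

/-- Near x the kernel is integrable and g bounded; off the unit ball the roles are exchanged. -/
theorem integrable_rieszKernel_sub_mul (hE : 1 ≤ Module.finrank ℝ E) (w x : E) {g : E → ℝ}
    (hg : Integrable g) {C : ℝ} (hC : ∀ y, |g y| ≤ C) :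
    Integrable fun y => rieszKernel w (y - x) * g y := by
  have hm : Measurable fun y => rieszKernel w (y - x) :=
    (measurable_rieszKernel w).comp (measurable_id.sub_const x)
  rw [← integrableOn_univ, ← Set.union_compl_self (Metric.ball x 1)]
  refine IntegrableOn.union ?_ ?_
  · have h1 : IntegrableOn (rieszKernel w) (Metric.ball 0 1) :=
      (locallyIntegrable_rieszKernel hE w).integrableOn_isCompact (isCompact_closedBall 0 1)
        |>.mono_set Metric.ball_subset_closedBall
    have h2 := ((measurePreserving_sub_right volume x).integrableOn_comp_preimage
      (MeasurableEquiv.subRight x).measurableEmbedding).mpr h1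
    have h3 : (fun y => y - x) ⁻¹' Metric.ball (0 : E) 1 = Metric.ball x 1 := by
      ext y; simp [dist_eq_norm]
    rw [h3] at h2
    exact Integrable.mul_bdd (c := C) h2 hg.aestronglyMeasurable.restrict (.of_forall hC)
  · refine Integrable.bdd_mul (c := ‖w‖) hg.integrableOn hm.aestronglyMeasurable.restrict ?_
    refine (ae_restrict_iff' Metric.isOpen_ball.measurableSet.compl).mpr (.of_forall fun y hy => ?_)
    have hy' : 1 ≤ ‖y - x‖ := by simpa [dist_eq_norm] using hy
    refine (abs_rieszKernel_le w _).trans ?_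
    refine mul_le_of_le_one_right (norm_nonneg _) (Real.rpow_le_one_of_one_le_of_nonpos hy' ?_)
    have : (1 : ℝ) ≤ Module.finrank ℝ E := by exact_mod_cast hE
    linarith

theorem integrableOn_rieszKernelDeriv_sub_mul (w x e : E) {g : E → ℝ} (hg : Integrable g)
    {ε : ℝ} (hε : 0 < ε) :
    IntegrableOn (fun y => rieszKernelDeriv w (y - x) e * g y) (Metric.ball x ε)ᶜ := by
  have hm : Measurable fun y => rieszKernelDeriv w (y - x) e :=
    (measurable_rieszKernelDeriv_apply w e).comp (measurable_id.sub_const x)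
  refine Integrable.bdd_mul
    (c := (Module.finrank ℝ E + 1) * ‖w‖ / ε ^ Module.finrank ℝ E * ‖e‖)
    hg.integrableOn hm.aestronglyMeasurable.restrict ?_
  refine (ae_restrict_iff' Metric.isOpen_ball.measurableSet.compl).mpr (.of_forall fun y hy => ?_)
  have hy' : ε ≤ ‖y - x‖ := by simpa [dist_eq_norm] using hy
  refine (ContinuousLinearMap.le_opNorm _ _).trans ?_
  gcongr
  refine (norm_rieszKernelDeriv_le w _).trans ?_
  gcongr

/-- The potential of a density vanishing near `x` is differentiated under the integral sign. -/
theorem hasFDerivAt_integral_rieszKernel_of_eq_zero (w x : E) {g : E → ℝ} (hg : Integrable g)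
    (hint : Integrable fun y => rieszKernel w (y - x) * g y) {R : ℝ} (hR : 0 < R)
    (hgR : ∀ y ∈ Metric.ball x R, g y = 0) :
    ∃ L : E →L[ℝ] ℝ, HasFDerivAt (fun x => ∫ y, rieszKernel w (y - x) * g y) L x ∧
      ∀ e, L e = -∫ y, rieszKernelDeriv w (y - x) e * g y := by
  -- Points within R / 2 of x stay at distance at least R / 2 from where g is nonzero, which makes
  -- the derivative bound uniform in x'.
  have hfar : ∀ x' ∈ Metric.ball x (R / 2), ∀ y, g y ≠ 0 → R / 2 ≤ ‖y - x'‖ := by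
    intro x' hx' y hy
    have h1 : R ≤ dist y x := by
      by_contra h
      exact hy (hgR y (by simpa using h))
    have h2 : dist x' x < R / 2 := hx'
    have h3 := dist_triangle y x' x
    rw [← dist_eq_norm]
    linarith
  have hbound : ∀ x' ∈ Metric.ball x (R / 2), ∀ y, ‖-(g y • rieszKernelDeriv w (y - x'))‖ ≤
      (Module.finrank ℝ E + 1) * ‖w‖ / (R / 2) ^ Module.finrank ℝ E * ‖g y‖ := by
    intro x' hx' y
    rcases eq_or_ne (g y) 0 with h0 | h0
    · simp [h0]
    rw [norm_neg, norm_smul, mul_comm]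
    gcongr
    refine (norm_rieszKernelDeriv_le w _).trans ?_
    have := hfar x' hx' y h0
    gcongr
  have hx : x ∈ Metric.ball x (R / 2) := Metric.mem_ball_self (half_pos hR)
  have hm : AEStronglyMeasurable (fun y => -(g y • rieszKernelDeriv w (y - x))) volume := by
    refine (hg.aestronglyMeasurable.smul (Measurable.aestronglyMeasurable ?_)).neg
    have hin : Measurable fun y : E => innerSL ℝ (y - x) :=
      ((innerSL ℝ).continuous.comp (continuous_id.sub continuous_const)).measurable
    unfold rieszKernelDeriv
    fun_prop
  have hbi := hg.norm.const_mul ((Module.finrank ℝ E + 1) * ‖w‖ / (R / 2) ^ Module.finrank ℝ E)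
  refine ⟨_, hasFDerivAt_integral_of_dominated_of_fderiv_le
    (F' := fun x' y => -(g y • rieszKernelDeriv w (y - x')))
    (Metric.ball_mem_nhds x (half_pos hR)) (.of_forall fun x' => ?_) hint hm
    (.of_forall fun y x' hx' => hbound x' hx' y) hbi (.of_forall fun y x' hx' => ?_), fun e => ?_⟩
  · exact (((measurable_rieszKernel w).comp
      (measurable_id.sub_const x')).aestronglyMeasurable).mul hg.aestronglyMeasurable
  · rcases eq_or_ne (g y) 0 with h0 | h0
    · simpa [h0] using hasFDerivAt_const (0 : ℝ) x'
    have hne : y - x' ≠ 0 := norm_pos_iff.mp ((half_pos hR).trans_le (hfar x' hx' y h0))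
    have h1 := (hasFDerivAt_rieszKernel w hne).comp x' ((hasFDerivAt_id x').const_sub y)
    refine (h1.mul_const (g y)).congr_fderiv ?_
    ext e
    simp
  · have hF : Integrable fun y => -(g y • rieszKernelDeriv w (y - x)) :=
      hbi.mono' hm (.of_forall fun y => hbound x hx y)
    rw [ContinuousLinearMap.integral_apply hF, ← integral_neg]
    refine integral_congr_ae (.of_forall fun y => ?_)
    simp [mul_comm]

/-- The potential is a convolution, so the derivative can be moved onto the smooth factor g, leaving
only the locally integrable kernel. -/
theorem hasFDerivAt_integral_rieszKernel_of_contDiff (hE : 1 ≤ Module.finrank ℝ E) (w x : E)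
    {g : E → ℝ} (hg : ContDiff ℝ 1 g) (hgc : HasCompactSupport g) :
    ∃ L : E →L[ℝ] ℝ, HasFDerivAt (fun x => ∫ y, rieszKernel w (y - x) * g y) L x ∧
      ∀ e, L e = ∫ z, rieszKernel w z * fderiv ℝ g (x + z) e := by
  -- In the convolution variable t = x - y the kernel appears reflected.
  have hf : LocallyIntegrable (fun t => rieszKernel w (-t)) := by
    simp_rw [rieszKernel_neg]
    exact (locallyIntegrable_rieszKernel hE w).neg
  have h := hgc.hasFDerivAt_convolution_right (ContinuousLinearMap.mul ℝ ℝ) (μ := volume) hf hg x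
  refine ⟨_, h.congr_of_eventuallyEq (.of_forall fun x => ?_), fun e => ?_⟩
  · simp only [convolution_def, ContinuousLinearMap.mul_apply']
    rw [← integral_sub_left_eq_self _ volume x]
    simp
  · rw [convolution_precompR_apply _ hf (hgc.fderiv ℝ) (hg.continuous_fderiv one_ne_zero),
      convolution_def, ← integral_neg_eq_self]
    simp

theorem tendsto_setIntegral_rieszKernelDeriv_sub_mul (hE : 1 ≤ Module.finrank ℝ E) (w x e : E)
    {g : E → ℝ} (hg : ContDiff ℝ 1 g) (hgc : HasCompactSupport g) :
    Tendsto (fun ε : ℝ => ∫ y in (Metric.ball x ε)ᶜ, rieszKernelDeriv w (y - x) e * g y) (𝓝[>] 0)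
      (𝓝 (-(∫ z, rieszKernel w z * fderiv ℝ g (x + z) e) -
        inner ℝ w e * (volume.real (Metric.ball (0 : E) 1) * g x))) := by
  have h := tendsto_setIntegral_rieszKernelDeriv_mul hE w e (g := fun z => g (x + z))
    (hg.comp (contDiff_const.add contDiff_id)) (hgc.comp_homeomorph (Homeomorph.addLeft x))
  simp only [fderiv_comp_add_left, add_zero] at h
  refine h.congr fun ε => ?_
  have hp := (measurePreserving_add_left volume x).setIntegral_preimage_emb
    (MeasurableEquiv.addLeft x).measurableEmbedding
    (fun y => rieszKernelDeriv w (y - x) e * g y) (Metric.ball x ε)ᶜ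
  rw [← hp]
  have : (fun z => x + z) ⁻¹' (Metric.ball x ε)ᶜ = (Metric.ball (0 : E) ε)ᶜ := by
    ext z; simp [dist_eq_norm]
  rw [this]
  simp

/-- Differentiability of the potential `∫_Ω K_w(y - x) g(y) dy` and the principal value formula
for its derivative. -/
theorem exists_hasFDerivAt_rieszPotential (hE : 1 ≤ Module.finrank ℝ E) {Ω : Set E}
    (hΩ : IsOpen Ω) (w : E) {g : E → ℝ} (hg : ContDiffOn ℝ 1 g Ω) (hgi : IntegrableOn g Ω)
    {C : ℝ} (hC : ∀ y ∈ Ω, |g y| ≤ C) {x : E} (hx : x ∈ Ω) :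
    ∃ L : E →L[ℝ] ℝ, HasFDerivAt (fun x => ∫ y in Ω, rieszKernel w (y - x) * g y) L x ∧
      ∀ e, Tendsto (fun ε : ℝ => ∫ y in Ω \ Metric.ball x ε, rieszKernelDeriv w (y - x) e * g y)
        (𝓝[>] 0)
        (𝓝 (-L e - inner ℝ w e * (volume.real (Metric.ball (0 : E) 1) * g x))) := by
  have hC0 : 0 ≤ C := (abs_nonneg _).trans (hC x hx)
  obtain ⟨R, hR, hRΩ⟩ := Metric.nhds_basis_closedBall.mem_iff.mp (hΩ.mem_nhds hx)
  -- The density splits into ψ = χ g, which is C^1 with compact support in Ω, and a remainder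
  -- vanishing on B(x, R / 2).
  let χ : ContDiffBump x := ⟨R / 2, R, half_pos hR, half_lt_self hR⟩
  let ψ : E → ℝ := fun y => χ y * g y
  have hts : tsupport ψ ⊆ Metric.closedBall x R := by
    refine (tsupport_mul_subset_left (f := χ) (g := g)).trans ?_
    rw [χ.tsupport_eq]
  have hψ : ContDiff ℝ 1 ψ := by
    refine contDiff_iff_contDiffAt.mpr fun y => ?_
    by_cases hy : y ∈ tsupport ψ
    swap
    · exact contDiffAt_const.congr_of_eventuallyEq (notMem_tsupport_iff_eventuallyEq.mp hy)
    exact χ.contDiffAt.mul (hg.contDiffAt (hΩ.mem_nhds (hRΩ (hts hy))))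
  have hψc : HasCompactSupport ψ := HasCompactSupport.mul_right χ.hasCompactSupport
  have hψi : Integrable ψ := hψ.continuous.integrable_of_hasCompactSupport hψc
  have hψ_notMem : ∀ y ∉ Ω, ψ y = 0 := fun y hy =>
    image_eq_zero_of_notMem_tsupport fun h => hy (hRΩ (hts h))
  have hψC : ∀ y, |ψ y| ≤ C := by
    intro y
    by_cases hy : y ∈ Ω
    · simp only [ψ, abs_mul, abs_of_nonneg χ.nonneg]
      exact (mul_le_of_le_one_left (abs_nonneg _) χ.le_one).trans (hC y hy)
    · simpa [hψ_notMem y hy] using hC0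
  let φ : E → ℝ := Ω.indicator g
  have hφi : Integrable φ := (integrable_indicator_iff hΩ.measurableSet).mpr hgi
  have hφC : ∀ y, |φ y| ≤ C := by
    intro y
    by_cases hy : y ∈ Ω
    · simpa [φ, hy] using hC y hy
    · simpa [φ, hy] using hC0
  have hωi : Integrable fun y => φ y - ψ y := hφi.sub hψi
  have hω : ∀ y ∈ Metric.ball x (R / 2), φ y - ψ y = 0 := by
    intro y hy
    have h1 : y ∈ Ω := hRΩ (Metric.ball_subset_closedBall
      (Metric.ball_subset_ball (half_le_self hR.le) hy))
    have h2 : χ y = 1 := χ.one_of_mem_closedBall (Metric.ball_subset_closedBall hy)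
    simp [φ, ψ, h1, h2]
  have hψx : ψ x = g x := by
    have := hω x (Metric.mem_ball_self (half_pos hR))
    rw [← sub_eq_zero.mp this]
    simp [φ, hx]
  have hKψ (x : E) := integrable_rieszKernel_sub_mul hE w x hψi hψC
  have hKφ (x : E) := integrable_rieszKernel_sub_mul hE w x hφi hφC
  have hKω (x : E) : Integrable fun y => rieszKernel w (y - x) * (φ y - ψ y) := by
    simp_rw [mul_sub]
    exact (hKφ x).sub (hKψ x)
  obtain ⟨L₁, hL₁, hL₁e⟩ := hasFDerivAt_integral_rieszKernel_of_contDiff hE w x hψ hψc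
  obtain ⟨L₂, hL₂, hL₂e⟩ := hasFDerivAt_integral_rieszKernel_of_eq_zero w x hωi (hKω x)
    (half_pos hR) hω
  refine ⟨L₁ + L₂, (hL₁.add hL₂).congr_of_eventuallyEq (.of_forall fun x => ?_), fun e => ?_⟩
  · simp only [Pi.add_apply]
    rw [← integral_add (hKψ x) (hKω x), ← integral_indicator hΩ.measurableSet]
    refine integral_congr_ae (.of_forall fun y => ?_)
    by_cases hy : y ∈ Ω
    · simp [φ, hy]; ring
    · simp [φ, hy]
  · have h1 := tendsto_setIntegral_rieszKernelDeriv_sub_mul hE w x e hψ hψc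
    rw [← hL₁e, hψx] at h1
    -- For ε < R / 2 the remainder vanishes on the removed ball, so its contribution does not depend
    -- on ε.
    have h2 := h1.add_const (∫ y, rieszKernelDeriv w (y - x) e * (φ y - ψ y))
    have h3 : -(L₁ + L₂) e - inner ℝ w e * (volume.real (Metric.ball (0 : E) 1) * g x) =
        -L₁ e - inner ℝ w e * (volume.real (Metric.ball (0 : E) 1) * g x) +
          ∫ y, rieszKernelDeriv w (y - x) e * (φ y - ψ y) := by
      rw [add_apply, hL₂e]
      ring
    rw [h3]
    refine h2.congr' ?_
    filter_upwards [Ioo_mem_nhdsGT (half_pos hR)] with ε hε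
    have h4 : ∫ y, rieszKernelDeriv w (y - x) e * (φ y - ψ y) =
        ∫ y in (Metric.ball x ε)ᶜ, rieszKernelDeriv w (y - x) e * (φ y - ψ y) := by
      refine (setIntegral_eq_integral_of_forall_compl_eq_zero fun y hy => ?_).symm
      rw [Set.notMem_compl_iff] at hy
      rw [hω y (Metric.ball_subset_ball hε.2.le hy), mul_zero]
    rw [h4, ← integral_add (integrableOn_rieszKernelDeriv_sub_mul w x e hψi hε.1)
      (integrableOn_rieszKernelDeriv_sub_mul w x e hωi hε.1), Set.sdiff_eq, Set.inter_comm,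
      ← setIntegral_indicator hΩ.measurableSet]
    refine integral_congr_ae (.of_forall fun y => ?_)
    by_cases hy : y ∈ Ω
    · simp [φ, hy]; ring
    · simp [φ, hy]

end RieszPotential

/-! ### Clifford-type relations in an alternative algebra. -/

section HypercomplexAlgebra

variable {A : Type*} [NonAssocRing A]

/-- Polarization of the left alternative law [a, a, p] = 0; it replaces associativity in what
follows. -/
theorem IsAlternativeRing.mul_mul_add_mul_mul (hA : IsAlternativeRing A) (a b p : A) :
    a * (b * p) + b * (a * p) = (a * b + b * a) * p := by
  have h := hA.left (a + b) p
  have ha := hA.left a p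
  have hb := hA.left b p
  simp only [associator_apply, add_mul, mul_add] at h ha hb ⊢
  rw [sub_eq_zero] at h ha hb
  rw [ha, hb] at h
  have h' : b * a * p + a * b * p = a * (b * p) + b * (a * p) := by
    have h2 := sub_eq_zero.mpr h
    rw [← sub_eq_zero, ← h2]
    abel
  rw [← h', add_comm]

variable [Module ℝ A] [StarRing A] {m : ℕ} {v : Fin (m + 1) → A}

theorem IsHypercomplexBasis.star_eq_neg (hv : IsHypercomplexBasis v) {s : Fin (m + 1)}
    (hs : s ≠ 0) : star (v s) = -v s :=
  (neg_eq_of_add_eq_zero_right (hv.mem_imaginaryUnits s hs).1).symm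

theorem IsHypercomplexBasis.mul_self (hv : IsHypercomplexBasis v) {s : Fin (m + 1)}
    (hs : s ≠ 0) : v s * v s = -1 := by
  have h := (hv.mem_imaginaryUnits s hs).2
  rw [hv.star_eq_neg hs, mul_neg] at h
  rw [← h, neg_neg]

theorem IsHypercomplexBasis.mul_star_mul_self (hA : IsAlternativeRing A)
    (hv : IsHypercomplexBasis v) (s : Fin (m + 1)) (p : A) : v s * (star (v s) * p) = p := by
  rcases eq_or_ne s 0 with rfl | hs
  · simp [hv.map_zero]
  · have h := hA.left (v s) p
    rw [associator_apply, sub_eq_zero, hv.mul_self hs] at h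
    rw [hv.star_eq_neg hs, neg_mul, mul_neg, ← h, neg_mul, one_mul, neg_neg]

theorem IsHypercomplexBasis.mul_star_mul_add (hA : IsAlternativeRing A)
    (hv : IsHypercomplexBasis v) {s t : Fin (m + 1)} (hst : s ≠ t) (p : A) :
    v s * (star (v t) * p) + v t * (star (v s) * p) = 0 := by
  rcases eq_or_ne s 0 with rfl | hs
  · simp [hv.map_zero, hv.star_eq_neg hst.symm]
  rcases eq_or_ne t 0 with rfl | ht
  · simp [hv.map_zero, hv.star_eq_neg hs]
  rw [hv.star_eq_neg hs, hv.star_eq_neg ht, neg_mul, neg_mul, mul_neg, mul_neg, ← neg_add,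
    hA.mul_mul_add_mul_mul, hv.anticomm s t hs ht hst, neg_add_cancel, zero_mul, neg_zero]

/-- A symmetric trace-free combination of the products `v_j (v_s^c p)` vanishes. -/
theorem IsHypercomplexBasis.sum_smul_mul_star_mul_eq_zero (hA : IsAlternativeRing A)
    (hv : IsHypercomplexBasis v) (c : Fin (m + 1) → Fin (m + 1) → ℝ) (hc : ∀ s t, c s t = c t s)
    (htr : ∑ s, c s s = 0) (p : A) :
    ∑ j, ∑ s, c s j • (v j * (star (v s) * p)) = 0 := by
  set S := ∑ j, ∑ s, c s j • (v j * (star (v s) * p)) with hS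
  -- Averaging with the index-swapped sum leaves only the diagonal, which is a multiple of the
  -- trace.
  have h1 : S = ∑ j, ∑ s, c s j • (v s * (star (v j) * p)) := by
    rw [hS, Finset.sum_comm]
    simp_rw [hc]
  have h2 : S + S = 0 := by
    nth_rewrite 2 [h1]
    rw [hS, ← Finset.sum_add_distrib]
    simp_rw [← Finset.sum_add_distrib, ← smul_add]
    have h3 : ∀ j, ∑ s, c s j • (v j * (star (v s) * p) + v s * (star (v j) * p)) =
        c j j • (p + p) := by
      intro j
      rw [Finset.sum_eq_single j]
      · rw [hv.mul_star_mul_self hA]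
      · intro s _ hsj
        rw [hv.mul_star_mul_add hA hsj.symm, smul_zero]
      · simp
    simp_rw [h3, ← Finset.sum_smul, htr, zero_smul]
  have h4 : (2 : ℝ) • S = 0 := by rw [two_smul, h2]
  exact (smul_eq_zero_iff_right two_ne_zero).mp h4

end HypercomplexAlgebra

/-! ### Componentwise calculus for finite sums of real functions times constant vectors. -/

section ComponentCalculus

variable {A : Type*} [NonAssocRing A] [Module ℝ A] {d n : ℕ} {ι : Type*} [Fintype ι]

theorem component_sum_smul {X : Type*} (b : Module.Basis (Fin (d + 1)) ℝ A) (G : ι → X → ℝ)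
    (a : ι → A) (t : Fin (d + 1)) :
    component b (fun y => ∑ i, G i y • a i) t = fun y => ∑ i, G i y * b.repr (a i) t := by
  ext y
  simp [component, Finsupp.finsetSum_apply]

theorem hasFDerivAt_component_sum_smul (b : Module.Basis (Fin (d + 1)) ℝ A)
    {G : ι → EuclideanSpace ℝ (Fin n) → ℝ} (a : ι → A) {x : EuclideanSpace ℝ (Fin n)}
    {L : ι → EuclideanSpace ℝ (Fin n) →L[ℝ] ℝ} (hG : ∀ i, HasFDerivAt (G i) (L i) x)
    (t : Fin (d + 1)) :
    HasFDerivAt (component b (fun y => ∑ i, G i y • a i) t) (∑ i, b.repr (a i) t • L i) x := by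
  rw [component_sum_smul]
  exact HasFDerivAt.fun_sum fun i _ => (hG i).mul_const _

theorem partialDeriv_sum_smul (b : Module.Basis (Fin (d + 1)) ℝ A)
    {G : ι → EuclideanSpace ℝ (Fin n) → ℝ} (a : ι → A) {x : EuclideanSpace ℝ (Fin n)}
    {L : ι → EuclideanSpace ℝ (Fin n) →L[ℝ] ℝ} (hG : ∀ i, HasFDerivAt (G i) (L i) x) (s : Fin n) :
    partialDeriv b s (fun y => ∑ i, G i y • a i) x =
      ∑ i, L i (EuclideanSpace.single s 1) • a i := by
  have h : ∀ t, lineDeriv ℝ (component b (fun y => ∑ i, G i y • a i) t) x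
      (EuclideanSpace.single s 1) =
      b.repr (∑ i, L i (EuclideanSpace.single s 1) • a i) t := by
    intro t
    rw [((hasFDerivAt_component_sum_smul b a hG t).hasLineDerivAt _).lineDeriv]
    simp [Finsupp.finsetSum_apply, mul_comm]
  simp_rw [partialDeriv, h]
  exact b.sum_repr _

/-- The expansion of g is required only off x, because every ball removed contains x; at x itself
the differentiated kernel has no meaningful value. -/
theorem pv_sum_smul (b : Module.Basis (Fin (d + 1)) ℝ A) {Ω : Set (EuclideanSpace ℝ (Fin n))}
    (hΩ : MeasurableSet Ω) {x : EuclideanSpace ℝ (Fin n)} {g : EuclideanSpace ℝ (Fin n) → A}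
    {G : ι → EuclideanSpace ℝ (Fin n) → ℝ} (a : ι → A) {l : ι → ℝ}
    (hg : ∀ y ∈ Ω, y ≠ x → g y = ∑ i, G i y • a i)
    (hG : ∀ i, ∀ ε > 0, IntegrableOn (G i) (Ω \ Metric.ball x ε))
    (hl : ∀ i, Tendsto (fun ε : ℝ => ∫ y in Ω \ Metric.ball x ε, G i y) (𝓝[>] 0) (𝓝 (l i))) :
    PVConvergent b Ω x g ∧ pvIntegral b Ω x g = ∑ i, l i • a i := by
  have hms (ε : ℝ) : MeasurableSet (Ω \ Metric.ball x ε) := hΩ.diff Metric.isOpen_ball.measurableSet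
  have hcongr (t : Fin (d + 1)) {ε : ℝ} (hε : 0 < ε) :
      Set.EqOn (fun y => ∑ i, G i y * b.repr (a i) t) (component b g t)
        (Ω \ Metric.ball x ε) := by
    intro y hy
    have hyx : y ≠ x := by
      rintro rfl
      exact hy.2 (Metric.mem_ball_self hε)
    rw [← component_sum_smul]
    simp only [component, hg y hy.1 hyx]
  have hlim (t : Fin (d + 1)) :
      Tendsto (fun ε : ℝ => ∫ y in Ω \ Metric.ball x ε, component b g t y) (𝓝[>] 0)
        (𝓝 (b.repr (∑ i, l i • a i) t)) := by
    have h1 : b.repr (∑ i, l i • a i) t = ∑ i, l i * b.repr (a i) t := by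
      simp [Finsupp.finsetSum_apply]
    rw [h1]
    refine (tendsto_finsetSum _ fun i _ => (hl i).mul_const (b.repr (a i) t)).congr' ?_
    filter_upwards [self_mem_nhdsWithin] with ε hε
    rw [← setIntegral_congr_fun (hms ε) (hcongr t hε),
      integral_finsetSum _ fun i _ => (hG i ε hε).mul_const _]
    simp_rw [integral_mul_const]
  refine ⟨fun t => ⟨fun ε hε => ?_, _, hlim t⟩, ?_⟩
  · exact IntegrableOn.congr_fun (integrable_finsetSum _ fun i _ => (hG i ε hε).mul_const _)
      (hcongr t hε) (hms ε)
  · simp_rw [pvIntegral, (hlim _).limUnder_eq]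
    exact b.sum_repr _

/-- Real functions are separated from constant products in `A`, so that no product of three elements
has to be rebracketed. -/
theorem sum_smul_mul_eq_sum_prod [IsScalarTower ℝ A A] [SMulCommClass ℝ A A]
    (b : Module.Basis (Fin (d + 1)) ℝ A) (r : ι → ℝ) (a : ι → A)
    (p : A) :
    (∑ s, r s • a s) * p = ∑ i : ι × Fin (d + 1), (r i.1 * b.repr p i.2) • (a i.1 * b i.2) := by
  conv_lhs => rw [← b.sum_repr p]
  rw [Finset.sum_mul_sum, Fintype.sum_prod_type]
  simp_rw [smul_mul_assoc, mul_smul_comm, smul_smul]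

end ComponentCalculus

/-! ### The Cauchy kernel in terms of Riesz kernels. -/

section Kernel

theorem volume_real_unit_ball (m : ℕ) :
    volume.real (Metric.ball (0 : EuclideanSpace ℝ (Fin (m + 1))) 1) =
      sphereArea m / (m + 1) := by
  have hn : (0 : ℝ) < ((m : ℝ) + 1) / 2 := by positivity
  have hΓ := Real.Gamma_pos_of_pos hn
  rw [Measure.real, EuclideanSpace.volume_ball, sphereArea, Real.Gamma_one_half_eq]
  simp only [ENNReal.ofReal_one, one_pow, one_mul, Fintype.card_fin, Nat.cast_add, Nat.cast_one]
  rw [Real.Gamma_add_one hn.ne', ENNReal.toReal_ofReal (by positivity)]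
  field_simp

theorem sphereArea_pos (m : ℕ) : 0 < sphereArea m := by
  have hn : (0 : ℝ) < ((m : ℝ) + 1) / 2 := by positivity
  have := Real.Gamma_pos_of_pos hn
  have := Real.Gamma_pos_of_pos (one_half_pos (α := ℝ))
  unfold sphereArea
  positivity

/-- Symmetry of second derivatives in disguise: the Riesz kernel is the w-derivative of a radial
function. -/
theorem rieszKernelDeriv_comm {E : Type*} [NormedAddCommGroup E] [InnerProductSpace ℝ E]
    (w z e : E) : rieszKernelDeriv w z e = rieszKernelDeriv e z w := by
  rw [rieszKernelDeriv_apply, rieszKernelDeriv_apply, real_inner_comm w e, real_inner_comm w z,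
    real_inner_comm e z]
  ring

/-- The field z / |z|^n is divergence-free off the origin; the exponent has to equal the dimension.
-/
theorem sum_rieszKernelDeriv_single {n : ℕ} {z : EuclideanSpace ℝ (Fin n)} (hz : z ≠ 0) :
    ∑ s, rieszKernelDeriv (EuclideanSpace.single s 1) z (EuclideanSpace.single s 1) = 0 := by
  have hz' : ‖z‖ ≠ 0 := norm_ne_zero_iff.mpr hz
  have h : ∑ s, z s * z s = ‖z‖ ^ 2 := by
    rw [EuclideanSpace.real_norm_sq_eq]
    simp_rw [pow_two]
  simp only [rieszKernelDeriv_apply, Finset.sum_sub_distrib, ← Finset.sum_div, mul_assoc,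
    ← Finset.mul_sum]
  simp only [EuclideanSpace.inner_single_left, EuclideanSpace.inner_single_right, map_one, one_mul,
    conj_trivial, h, PiLp.single_apply, if_true, Finset.sum_const, Finset.card_univ,
    Fintype.card_fin, finrank_euclideanSpace, nsmul_eq_mul, mul_one]
  field_simp
  ring

variable {A : Type*} [NonAssocRing A] [Module ℝ A] [StarRing A] [StarModule ℝ A] {d m : ℕ}

theorem cauchyKernelAt_eq_sum (v : Fin (m + 1) → A) (y x : EuclideanSpace ℝ (Fin (m + 1))) :
    cauchyKernelAt v y x = ∑ s, rieszKernel (EuclideanSpace.single s 1) (y - x) •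
      ((1 / sphereArea m) • star (v s)) := by
  rw [cauchyKernelAt, cauchyKernel, hypercomplexPoint, star_sum, Finset.smul_sum]
  refine Finset.sum_congr rfl fun s _ => ?_
  rw [star_smul, star_trivial, smul_smul, smul_smul]
  congr 1
  simp [rieszKernel, EuclideanSpace.inner_single_left]
  field_simp

/-- The minus sign comes from differentiating y - x in x. -/
theorem partialDeriv_cauchyKernelAt (b : Module.Basis (Fin (d + 1)) ℝ A) (v : Fin (m + 1) → A)
    (j : Fin (m + 1)) {y x : EuclideanSpace ℝ (Fin (m + 1))} (hyx : y ≠ x) :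
    partialDeriv b j (cauchyKernelAt v y) x =
      ∑ s, rieszKernelDeriv (EuclideanSpace.single s 1) (y - x) (EuclideanSpace.single j 1) •
        (-((1 / sphereArea m) • star (v s))) := by
  have h (s : Fin (m + 1)) := (hasFDerivAt_rieszKernel (EuclideanSpace.single s 1)
    (sub_ne_zero.mpr hyx)).comp x ((hasFDerivAt_id x).const_sub y)
  have h1 : cauchyKernelAt v y = _ := funext fun x => cauchyKernelAt_eq_sum v y x
  rw [h1]
  refine (partialDeriv_sum_smul b _ h j).trans ?_
  simp

end Kernel

/-! ### The Teodorescu transform. -/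

theorem mainTheorem4 {A : Type*} [NonAssocRing A] [Module ℝ A] [IsScalarTower ℝ A A]
    [SMulCommClass ℝ A A] [StarRing A] [StarModule ℝ A] (hA : IsAlternativeRing A)
    {m d : ℕ} (hmd : m ≤ d) (v : Fin (m + 1) → A) (hv : IsHypercomplexBasis v)
    (b : Module.Basis (Fin (d + 1)) ℝ A)
    (hb : ∀ s : Fin (m + 1), b (Fin.castLE (Nat.succ_le_succ hmd) s) = v s)
    (Ω : Set (EuclideanSpace ℝ (Fin (m + 1)))) (hΩ_open : IsOpen Ω) (hΩ_conn : IsConnected Ω)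
    (hΩ_bdd : Bornology.IsBounded Ω) (hΩ_smooth : HasSmoothBoundary Ω)
    (f : EuclideanSpace ℝ (Fin (m + 1)) → A) (hf : ContDiffOnComponents b 1 f Ω)
    (hf_cont : ContinuousOnComponents b f (closure Ω)) :
    ∀ x ∈ Ω,
      PVConvergent b Ω x (fun y => cauchyKernelAt v y x * f y) ∧
      DifferentiableAtComponents b (teodorescu b v Ω f) x ∧
      (∀ s : Fin (m + 1),
        PVConvergent b Ω x (fun y => partialDeriv b s (cauchyKernelAt v y) x * f y) ∧
        partialDeriv b s (teodorescu b v Ω f) x =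
          -pvIntegral b Ω x (fun y => partialDeriv b s (cauchyKernelAt v y) x * f y) +
            (1 / ((m : ℝ) + 1)) • (star (v s) * f x)) ∧
      cauchyRiemann b v (teodorescu b v Ω f) x = f x := by
  intro x hx
  have hσ := sphereArea_pos m
  have hE : 1 ≤ Module.finrank ℝ (EuclideanSpace ℝ (Fin (m + 1))) := by simp
  let e : Fin (m + 1) → EuclideanSpace ℝ (Fin (m + 1)) := fun s => EuclideanSpace.single s 1
  let φ : Fin (d + 1) → EuclideanSpace ℝ (Fin (m + 1)) → ℝ := component b f
  have hf1 (u) : ContDiffOn ℝ 1 (φ u) Ω := by simpa only [Nat.cast_one] using hf u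
  have hcpt : IsCompact (closure Ω) := hΩ_bdd.isCompact_closure
  have hφi (u) : IntegrableOn (φ u) Ω :=
    ((hf_cont u).integrableOn_compact hcpt).mono_set subset_closure
  have hφC (u) : ∃ C, ∀ y ∈ Ω, |φ u y| ≤ C := by
    obtain ⟨C, hC⟩ := hcpt.exists_bound_of_continuousOn (hf_cont u)
    exact ⟨C, fun y hy => hC y (subset_closure hy)⟩
  have hφi' (u) : Integrable (Ω.indicator (φ u)) :=
    (integrable_indicator_iff hΩ_open.measurableSet).mpr (hφi u)
  -- Needed for every x: differentiating the transform requires its formula at neighbouring points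
  -- too.
  have hK (s u) (x) : IntegrableOn (fun y => rieszKernel (e s) (y - x) * φ u y) Ω := by
    obtain ⟨C, hC⟩ := hφC u
    have h := integrable_rieszKernel_sub_mul hE (e s) x (hφi' u) (C := |C|) fun y => by
      by_cases hy : y ∈ Ω
      · simpa [hy] using (hC y hy).trans (le_abs_self C)
      · simp [hy]
    have h' : (fun y => rieszKernel (e s) (y - x) * Ω.indicator (φ u) y) =
        Ω.indicator fun y => rieszKernel (e s) (y - x) * φ u y :=
      funext fun _ => (Set.indicator_mul_right Ω (fun y => rieszKernel (e s) (y - x)) (φ u)).symm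
    rw [h'] at h
    exact (integrable_indicator_iff hΩ_open.measurableSet).mp h
  have hD (s j u) (ε : ℝ) (hε : ε > 0) : IntegrableOn
      (fun y => rieszKernelDeriv (e s) (y - x) (e j) * φ u y) (Ω \ Metric.ball x ε) := by
    have h := integrableOn_rieszKernelDeriv_sub_mul (e s) x (e j) (hφi' u) hε
    have h' : (fun y => rieszKernelDeriv (e s) (y - x) (e j) * Ω.indicator (φ u) y) =
        Ω.indicator fun y => rieszKernelDeriv (e s) (y - x) (e j) * φ u y :=
      funext fun _ =>
        (Set.indicator_mul_right Ω (fun y => rieszKernelDeriv (e s) (y - x) (e j)) (φ u)).symm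
    rw [h', IntegrableOn, integrable_indicator_iff hΩ_open.measurableSet, IntegrableOn,
      Measure.restrict_restrict hΩ_open.measurableSet, ← Set.sdiff_eq] at h
    exact h
  choose C hC using hφC
  have hmain (i : Fin (m + 1) × Fin (d + 1)) := exists_hasFDerivAt_rieszPotential hE hΩ_open
    (e i.1) (hf1 i.2) (hφi i.2) (hC i.2) hx
  choose L hL hlim using hmain
  let a : Fin (m + 1) × Fin (d + 1) → A := fun i => ((1 / sphereArea m) • star (v i.1)) * b i.2
  have hsum (y x) : cauchyKernelAt v y x * f y =
      ∑ i, (rieszKernel (e i.1) (y - x) * φ i.2 y) • a i := by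
    rw [cauchyKernelAt_eq_sum]
    exact sum_smul_mul_eq_sum_prod b _ _ _
  have hsumD (j) (y) (hyx : y ≠ x) : partialDeriv b j (cauchyKernelAt v y) x * f y =
      ∑ i, (rieszKernelDeriv (e i.1) (y - x) (e j) * φ i.2 y) • (-a i) := by
    rw [partialDeriv_cauchyKernelAt b v j hyx, sum_smul_mul_eq_sum_prod b]
    simp only [neg_mul, a, e, φ, component]
  have hpv (x) : PVConvergent b Ω x (fun y => cauchyKernelAt v y x * f y) ∧
      pvIntegral b Ω x (fun y => cauchyKernelAt v y x * f y) =
        ∑ i, (∫ y in Ω, rieszKernel (e i.1) (y - x) * φ i.2 y) • a i :=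
    pv_sum_smul b hΩ_open.measurableSet a (fun y _ _ => hsum y x)
      (fun i ε _ => (hK i.1 i.2 x).mono_set Set.sdiff_subset)
      (fun i => tendsto_setIntegral_diff_ball x (hK i.1 i.2 x))
  have hT : teodorescu b v Ω f = fun x => ∑ i : Fin (m + 1) × Fin (d + 1),
      (∫ y in Ω, rieszKernel (e i.1) (y - x) * φ i.2 y) • (-a i) := by
    ext x
    rw [teodorescu, (hpv x).2]
    simp
  have hpvD (j : Fin (m + 1)) := pv_sum_smul b hΩ_open.measurableSet (fun i => -a i)
    (fun y _ hyx => hsumD j y hyx) (fun i => hD i.1 j i.2) (fun i => hlim i (e j))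
  have hinner (s j : Fin (m + 1)) : inner ℝ (e s) (e j) = if s = j then (1 : ℝ) else 0 := by
    simp [e, EuclideanSpace.inner_single_left]
  -- The factor 1/σ_m in `a` cancels the σ_m in the volume of the unit ball.
  have hjump (j : Fin (m + 1)) :
      ∑ i : Fin (m + 1) × Fin (d + 1), (inner ℝ (e i.1) (e j) *
        (sphereArea m / (m + 1) * φ i.2 x)) • a i =
      (1 / ((m : ℝ) + 1)) • (star (v j) * f x) := by
    rw [Fintype.sum_prod_type, Finset.sum_eq_single j]
    · conv_rhs => rw [← b.sum_repr (f x)]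
      rw [Finset.mul_sum, Finset.smul_sum]
      refine Finset.sum_congr rfl fun u _ => ?_
      simp only [hinner, if_true, a, φ, component, smul_mul_assoc, mul_smul_comm, smul_smul]
      congr 1
      field_simp
    · intro s _ hs
      simp [hinner, hs]
    · simp
  have hpd (j : Fin (m + 1)) : partialDeriv b j (teodorescu b v Ω f) x =
      -pvIntegral b Ω x (fun y => partialDeriv b j (cauchyKernelAt v y) x * f y) +
        (1 / ((m : ℝ) + 1)) • (star (v j) * f x) := by
    rw [hT, partialDeriv_sum_smul b _ hL j, (hpvD j).2, ← hjump j, ← Finset.sum_neg_distrib,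
      ← Finset.sum_add_distrib]
    refine Finset.sum_congr rfl fun i _ => ?_
    rw [volume_real_unit_ball]
    module
  refine ⟨(hpv x).1, fun t => ?_, fun s => ⟨(hpvD s).1, hpd s⟩, ?_⟩
  · rw [hT]
    exact (hasFDerivAt_component_sum_smul b _ hL t).differentiableAt
  -- These are the scalar principal values. Symmetry and vanishing trace pass to them from the
  -- integrands by uniqueness of limits.
  · let l : Fin (d + 1) → Fin (m + 1) → Fin (m + 1) → ℝ := fun u s j => -L (s, u) (e j) -
      inner ℝ (e s) (e j) *
        (volume.real (Metric.ball (0 : EuclideanSpace ℝ (Fin (m + 1))) 1) * φ u x)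
    have hl (u s j) : Tendsto (fun ε : ℝ => ∫ y in Ω \ Metric.ball x ε,
        rieszKernelDeriv (e s) (y - x) (e j) * φ u y) (𝓝[>] 0) (𝓝 (l u s j)) := hlim (s, u) (e j)
    have hsymm (u s j) : l u s j = l u j s := by
      refine tendsto_nhds_unique (hl u s j) ?_
      simp_rw [rieszKernelDeriv_comm (e s)]
      exact hl u j s
    have htr (u) : ∑ s, l u s s = 0 := by
      refine tendsto_nhds_unique (tendsto_finsetSum _ fun s _ => hl u s s) ?_
      refine tendsto_const_nhds.congr' ?_
      filter_upwards [self_mem_nhdsWithin] with ε (hε : 0 < ε)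
      rw [← integral_finsetSum _ fun s _ => hD s s u ε hε]
      refine (setIntegral_eq_zero_of_forall_eq_zero fun y hy => ?_).symm
      have hyx : y - x ≠ 0 := by
        rw [sub_ne_zero]
        rintro rfl
        exact hy.2 (Metric.mem_ball_self hε)
      rw [← Finset.sum_mul, sum_rieszKernelDeriv_single hyx, zero_mul]
    have hzero : ∑ j, v j *
        pvIntegral b Ω x (fun y => partialDeriv b j (cauchyKernelAt v y) x * f y) = 0 := by
      have h1 (j : Fin (m + 1)) : v j *
          pvIntegral b Ω x (fun y => partialDeriv b j (cauchyKernelAt v y) x * f y) =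
          ∑ u, (-(1 / sphereArea m)) • ∑ s, l u s j • (v j * (star (v s) * b u)) := by
        rw [(hpvD j).2, Fintype.sum_prod_type_right, Finset.mul_sum]
        refine Finset.sum_congr rfl fun u _ => ?_
        rw [Finset.mul_sum, Finset.smul_sum]
        refine Finset.sum_congr rfl fun s _ => ?_
        simp only [a, smul_mul_assoc, ← neg_smul, mul_smul_comm, smul_smul]
        congr 1
        simp only [l]
        ring
      simp_rw [h1]
      rw [Finset.sum_comm]
      simp_rw [← Finset.smul_sum, hv.sum_smul_mul_star_mul_eq_zero hA (l _) (hsymm _) (htr _)]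
      simp
    -- Only the jump terms survive: m + 1 copies of f(x) / (m + 1).
    simp_rw [cauchyRiemann, hpd, mul_add, mul_neg, mul_smul_comm, hv.mul_star_mul_self hA]
    rw [Finset.sum_add_distrib, Finset.sum_neg_distrib, hzero, neg_zero, zero_add,
      Finset.sum_const, Finset.card_univ, Fintype.card_fin, ← Nat.cast_smul_eq_nsmul ℝ, smul_smul]
    push_cast
    rw [mul_one_div_cancel (by positivity), one_smul]
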